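/- Let $G$ be a second countable, locally compact Hausdorff étale groupoid with unit space $G^{0}$, range and source maps $r,s$, and $G^{u}=r^{-1}(u)$, $G_u=s^{-1}(u)$ for $u\in G^0$. Let $G^{0}\times\mathbf T\xrightarrow{\iota}E\xrightarrow{q}G$ be a twist over $G$: $E$ is a topological groupoid whose unit space is identified with $G^0$; $\iota$ and $q$ are continuous groupoid homomorphisms fixing the unit space; $\iota$ is a homeomorphism onto its range; $q$ is an open surjection whose kernel $q^{-1}(G^0)$ is the range of $\iota$; and $\iota(r(e),z)\,e=e\,\iota(s(e),z)$ for all $e\in E$, $z\in\mathbf T$. Write $z\cdot e=\iota(r(e),z)\,e$, and call $f\colon E\to\mathbf C$ equivariant if $f(z\cdot e)=zf(e)$ for all $z\in\mathbf T$, $e\in E$. Let $C_c(G;E)$ be the space of continuous equivariant functions $f$ on $E$ that vanish outside $q^{-1}(K)$ for some compact $K\subset G$. Let $C_0(G;E)$ be the Banach space, with the supremum norm, of continuous equivariant functions $f$ on $E$ such that $q(e)\mapsto|f(e)|$ vanishes at infinity on $G$. For equivariant $\xi$ on $E$, $|\xi|$ is a function on $G$; let $\ell^{2}(G;E)$ be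 the Hilbert space of all equivariant (not necessarily continuous) $\xi$ with $\sum_{\gamma\in G}|\xi|^2(\gamma)<\infty$; it is the Hilbert space direct sum over $u\in G^0$ of its subspaces of functions supported on $q^{-1}(G_u)$. The regular representation of $f\in C_c(G;E)$ on $\ell^{2}(G;E)$ is the bounded operator $(\lambda(f)\xi)(e)=\sum_{q(e_1)\in G^{r(e)}}f(e_1)\,\xi(e_1^{-1}e)$. The reduced $C^*$-algebra $C^*_r(G;E)$ is the $C^*$-algebra of operators on $\ell^{2}(G;E)$ generated by $\lambda(C_c(G;E))$, and $f\in C_c(G;E)$ is identified with $\lambda(f)$. Then there is an injective, norm-reducing (that is, $\|j(a)\|_\infty\le\|a\|$) linear map $j\colon C^*_r(G;E)\to C_0(G;E)$ such that $j(f)=f$ for all $f\in C_c(G;E)$. Moreover, for all $a,b\in C^*_r(G;E)$ and $e,e'\in E$, $$j(a^*)(e)=\overline{j(a)(e^{-1})}\qquad\text{and}\qquad j(a*b)(e')=\sum_{q(e)\in G^{r(e')}}j(a)(e)\,j(b)(e^{-1}e').$$ Here the sum is over the elements $\eta$ of $G^{r(e')}$, with any one point $e\in q^{-1}(\eta)$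 chosen for each $\eta$ (the term depends only on $\eta$), and it converges absolutely. -/

import Mathlib

open Topology Filter
open scoped BoundedContinuousFunction ComplexConjugate ENNReal

/-! Topological groupoids, described by their arrows -/

/-- A groupoid, given by its set `G` of arrows.  The unit space is the set of `x` with `r x = x`,
and `x * y` is meaningful exactly when `s x = r y`; no law restricts `x * y` for other pairs, and
no definition below looks at such a product. -/
class ArrowGroupoid (G : Type*) extends Mul G, Inv G where
  /-- the range of an arrow -/
  r : G → G
  /-- the source of an arrow -/
  s : G → G
  r_r : ∀ x, r (r x) = r x
  s_r : ∀ x, s (r x) = r x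
  r_s : ∀ x, r (s x) = s x
  s_s : ∀ x, s (s x) = s x
  r_mul' : ∀ x y, s x = r y → r (x * y) = r x
  s_mul' : ∀ x y, s x = r y → s (x * y) = s y
  mul_assoc' : ∀ x y z, s x = r y → s y = r z → x * y * z = x * (y * z)
  r_mul_self : ∀ x, r x * x = x
  mul_s_self : ∀ x, x * s x = x
  r_inv' : ∀ x, r x⁻¹ = s x
  s_inv' : ∀ x, s x⁻¹ = r x
  mul_inv' : ∀ x, x * x⁻¹ = r x
  inv_mul' : ∀ x, x⁻¹ * x = s x

namespace ArrowGroupoid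

/-- The unit space of a groupoid, as a set of arrows. -/
def units (G : Type*) [ArrowGroupoid G] : Set G := {x | r x = x}

/-- The range map, with values in the unit space. -/
def rangeUnit {G : Type*} [ArrowGroupoid G] (x : G) : units G := ⟨r x, r_r x⟩

/-- The source map, with values in the unit space. -/
def sourceUnit {G : Type*} [ArrowGroupoid G] (x : G) : units G := ⟨s x, r_s x⟩

/-- A topological groupoid: inversion is continuous, and multiplication is continuous on the set
of composable pairs. -/
class IsTopological (G : Type*) [TopologicalSpace G] [ArrowGroupoid G] : Prop where
  continuous_inv : Continuous fun x : G => x⁻¹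
  continuous_mul : Continuous fun p : {p : G × G // s p.1 = r p.2} => p.1.1 * p.1.2

/-- An étale groupoid: a topological groupoid whose range map is a local homeomorphism onto the
unit space. -/
class IsEtale (G : Type*) [TopologicalSpace G] [ArrowGroupoid G] : Prop extends
    IsTopological G where
  isLocalHomeomorph_range : IsLocalHomeomorph (rangeUnit : G → units G)

section Algebra

variable {G : Type*} [ArrowGroupoid G]

theorem inv_mul_cancel_left' {x y : G} (h : s x = r y) : x⁻¹ * (x * y) = y := by
  rw [← mul_assoc' _ _ _ (s_inv' x) h, inv_mul', h, r_mul_self]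

theorem mul_inv_cancel_left' {x y : G} (h : r x = r y) : x * (x⁻¹ * y) = y := by
  rw [← mul_assoc' _ _ _ (r_inv' x).symm ((s_inv' x).trans h), mul_inv', h, r_mul_self]

theorem eq_inv_of_mul {x y : G} (h : s x = r y) (h' : x * y = r x) : y = x⁻¹ := by
  rw [← inv_mul_cancel_left' h, h', ← s_inv', mul_s_self]

theorem inv_inv' (x : G) : x⁻¹⁻¹ = x :=
  (eq_inv_of_mul (s_inv' x) (by rw [inv_mul', r_inv'])).symm

end Algebra

section Counting

variable {G : Type*} [TopologicalSpace G] [ArrowGroupoid G] [IsEtale G]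

theorem exists_card_le_range {K : Set G} (hK : IsCompact K) :
    ∃ N : ℕ, ∀ (u : G) (A : Finset G), (∀ x ∈ A, x ∈ K ∧ r x = u) → A.card ≤ N := by
  have hloc : ∀ x : G, ∃ U ∈ 𝓝 x, Set.InjOn (rangeUnit : G → units G) U := by
    intro x
    obtain ⟨φ, hx, hφ⟩ := IsEtale.isLocalHomeomorph_range (G := G) x
    exact ⟨φ.source, φ.open_source.mem_nhds hx, by rw [hφ]; exact φ.injOn⟩
  choose U hU hinj using hloc
  obtain ⟨t, -, ht⟩ := hK.elim_nhds_subcover U fun x _ => hU x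
  refine ⟨t.card, fun u A hA => ?_⟩
  have hcov : ∀ x : G, ∃ i, x ∈ A → i ∈ t ∧ x ∈ U i := by
    intro x
    by_cases hx : x ∈ A
    · have := ht (hA x hx).1
      simp only [Set.mem_iUnion] at this
      obtain ⟨i, hi, hxi⟩ := this
      exact ⟨i, fun _ => ⟨hi, hxi⟩⟩
    · exact ⟨x, fun h => absurd h hx⟩
  choose i hi using hcov
  refine Finset.card_le_card_of_injOn i (fun x hx => (hi x hx).1) ?_
  intro x hx y hy hxy
  refine hinj (i x) (hi x hx).2 (hxy ▸ (hi y hy).2) ?_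
  exact Subtype.ext (((hA x hx).2).trans (hA y hy).2.symm)

theorem exists_card_le_source {K : Set G} (hK : IsCompact K) :
    ∃ N : ℕ, ∀ (u : G) (A : Finset G), (∀ x ∈ A, x ∈ K ∧ s x = u) → A.card ≤ N := by
  classical
  obtain ⟨N, hN⟩ := exists_card_le_range (hK.image (IsTopological.continuous_inv (G := G)))
  refine ⟨N, fun u A hA => ?_⟩
  have hinj : Function.Injective fun x : G => x⁻¹ := fun x y h => by
    have : x⁻¹⁻¹ = y⁻¹⁻¹ := congrArg (fun z : G => z⁻¹) h
    rwa [inv_inv', inv_inv'] at this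
  rw [← Finset.card_image_of_injective A hinj]
  refine hN u _ fun x hx => ?_
  obtain ⟨y, hy, rfl⟩ := Finset.mem_image.1 hx
  exact ⟨⟨y, (hA y hy).1, rfl⟩, (r_inv' y).trans (hA y hy).2⟩

end Counting

end ArrowGroupoid

open ArrowGroupoid

/-! Twists -/

/-- A twist `G⁰ × 𝕋 → E → G` over `G`: a central groupoid extension of `G` by the trivial circle
bundle over the unit space of `G`. -/
structure GroupoidTwist (G E : Type*) [TopologicalSpace G] [ArrowGroupoid G]
    [TopologicalSpace E] [ArrowGroupoid E] where
  /-- the inclusion of the trivial circle bundle -/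
  ι : units G × Circle → E
  /-- the projection onto `G` -/
  q : E → G
  r_ι : ∀ u z, r (ι (u, z)) = ι (u, 1)
  s_ι : ∀ u z, s (ι (u, z)) = ι (u, 1)
  ι_mul : ∀ u z w, ι (u, z) * ι (u, w) = ι (u, z * w)
  isEmbedding_ι : IsEmbedding ι
  q_r : ∀ e, q (r e) = r (q e)
  q_s : ∀ e, q (s e) = s (q e)
  q_mul : ∀ e f, s e = r f → q (e * f) = q e * q f
  continuous_q : Continuous q
  isOpenMap_q : IsOpenMap q
  surjective_q : Function.Surjective q
  q_ι : ∀ u z, q (ι (u, z)) = u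
  range_ι : Set.range ι = q ⁻¹' units G
  central : ∀ e z, ι (rangeUnit (q e), z) * e = e * ι (sourceUnit (q e), z)

namespace GroupoidTwist

variable {G E : Type*} [TopologicalSpace G] [ArrowGroupoid G] [TopologicalSpace E]
  [ArrowGroupoid E] (T : GroupoidTwist G E)

/-- The action of the circle on `E`. -/
def act (z : Circle) (e : E) : E := T.ι (rangeUnit (T.q e), z) * e

/-- The functions `f : E → ℂ` with `f (z · e) = z f(e)`; they correspond to the sections of the
complex line bundle over `G` attached to the twist. -/
def IsEquivariant (f : E → ℂ) : Prop := ∀ (z : Circle) (e : E), f (T.act z e) = z * f e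

/-- Some choice of one point in every fibre of `q`. -/
noncomputable def lift : G → E := Function.surjInv T.surjective_q

theorem q_lift (γ : G) : T.q (T.lift γ) = γ := Function.surjInv_eq _ γ

/-! Algebra of the extension -/

section Algebra

variable {T}

theorem r_eq_ι (e : E) : r e = T.ι (rangeUnit (T.q e), 1) := by
  have h : r e ∈ Set.range T.ι := by
    rw [T.range_ι]
    change r (T.q (r e)) = T.q (r e)
    rw [T.q_r, r_r]
  obtain ⟨⟨u, z⟩, hu⟩ := h
  have h1 : r e = T.ι (u, 1) := by rw [← T.r_ι u z, hu, r_r]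
  have h2 : rangeUnit (T.q e) = u := by
    apply Subtype.ext
    change r (T.q e) = u
    rw [← T.q_r, h1, T.q_ι]
  rw [h2, h1]

theorem r_eq_iff {e f : E} : r e = r f ↔ r (T.q e) = r (T.q f) := by
  constructor
  · intro h
    rw [← T.q_r, h, T.q_r]
  · intro h
    rw [r_eq_ι (T := T) e, r_eq_ι (T := T) f]
    congr 2
    exact Subtype.ext h

theorem q_inv (e : E) : T.q e⁻¹ = (T.q e)⁻¹ := by
  apply eq_inv_of_mul
  · rw [← T.q_s, ← T.q_r, r_inv']
  · rw [← T.q_mul _ _ (r_inv' e).symm, mul_inv', T.q_r]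

theorem s_eq_iff {e f : E} : s e = s f ↔ s (T.q e) = s (T.q f) := by
  rw [← r_inv', ← r_inv', r_eq_iff (T := T), q_inv, q_inv, r_inv', r_inv']

theorem s_ι_eq_r (e : E) (z : Circle) : s (T.ι (rangeUnit (T.q e), z)) = r e := by
  rw [T.s_ι, r_eq_ι (T := T)]

theorem q_act (z : Circle) (e : E) : T.q (T.act z e) = T.q e := by
  rw [act, T.q_mul _ _ (s_ι_eq_r e z), T.q_ι]
  exact r_mul_self _

theorem r_act (z : Circle) (e : E) : r (T.act z e) = r e :=
  (r_eq_iff (T := T)).2 (by rw [q_act])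

theorem act_act (z w : Circle) (e : E) : T.act z (T.act w e) = T.act (z * w) e := by
  have h : T.act z (T.act w e) = T.ι (rangeUnit (T.q e), z) * T.act w e := by
    conv_lhs => rw [act, q_act]
  rw [h, act, act, ← mul_assoc' _ _ _ _ (s_ι_eq_r e w), T.ι_mul]
  rw [T.s_ι, T.r_ι]

theorem act_injective (e : E) : Function.Injective fun z => T.act z e := by
  intro z w h
  have key : ∀ z, T.act z e * e⁻¹ = T.ι (rangeUnit (T.q e), z) := by
    intro z
    rw [act, mul_assoc' _ _ _ (s_ι_eq_r e z) (r_inv' e).symm, mul_inv', ← s_ι_eq_r (T := T) e z,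
      mul_s_self]
  have := T.isEmbedding_ι.injective ((key z).symm.trans ((congrArg (· * e⁻¹) h).trans (key w)))
  exact (Prod.ext_iff.1 this).2

theorem exists_act {e f : E} (h : T.q e = T.q f) : ∃ z, T.act z e = f := by
  have hs : s f = s e := (s_eq_iff (T := T)).2 (by rw [h])
  have hc : s f = r e⁻¹ := by rw [r_inv', hs]
  have hq : T.q (f * e⁻¹) = r (T.q e) := by rw [T.q_mul _ _ hc, q_inv, h, mul_inv']
  have hm : f * e⁻¹ ∈ Set.range T.ι := by
    rw [T.range_ι]
    change r (T.q (f * e⁻¹)) = T.q (f * e⁻¹)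
    rw [hq, r_r]
  obtain ⟨⟨u, z⟩, hu⟩ := hm
  have hu' : rangeUnit (T.q e) = u := by
    apply Subtype.ext
    change r (T.q e) = u
    rw [← hq, ← hu, T.q_ι]
  refine ⟨z, ?_⟩
  rw [act, hu', hu, mul_assoc' _ _ _ hc (s_inv' e), ArrowGroupoid.inv_mul', ← hs, mul_s_self]

/-- `e⁻¹ (z · f) = z · (e⁻¹ f)`. -/
theorem inv_mul_act {e f : E} (h : r e = r f) (z : Circle) :
    e⁻¹ * T.act z f = T.act z (e⁻¹ * f) := by
  have hc : s e⁻¹ = r f := (s_inv' e).trans h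
  have hq : r (T.q f) = s (T.q e⁻¹) := by rw [← T.q_s, ← T.q_r, hc]
  have hu : rangeUnit (T.q f) = sourceUnit (T.q e⁻¹) := Subtype.ext hq
  have hu' : rangeUnit (T.q (e⁻¹ * f)) = rangeUnit (T.q e⁻¹) := by
    apply Subtype.ext
    change r (T.q (e⁻¹ * f)) = r (T.q e⁻¹)
    rw [← T.q_r, ← T.q_r, r_mul' _ _ hc]
  have h1 : s e⁻¹ = r (T.ι (rangeUnit (T.q f), z)) := by
    rw [T.r_ι, ← r_eq_ι, hc]
  rw [act, act, ← mul_assoc' _ _ _ h1 (s_ι_eq_r f z), hu, ← T.central, hu',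
    mul_assoc' _ _ _ (s_ι_eq_r _ z) hc]

theorem IsEquivariant.norm_eq {f : E → ℂ} (hf : T.IsEquivariant f) {e e' : E}
    (h : T.q e = T.q e') : ‖f e‖ = ‖f e'‖ := by
  obtain ⟨z, rfl⟩ := exists_act h
  rw [hf, norm_mul, Circle.norm_coe, one_mul]

end Algebra

/-! Function spaces -/

/-- `C_c(G; E)`: the continuous equivariant functions on `E` whose support, seen in `G`, is
contained in a compact set. -/
def Cc : Submodule ℂ C(E, ℂ) where
  carrier := {f | T.IsEquivariant f ∧ ∃ K : Set G, IsCompact K ∧ ∀ e, T.q e ∉ K → f e = 0}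
  zero_mem' := ⟨fun z e => by simp, ∅, isCompact_empty, fun e _ => rfl⟩
  add_mem' := by
    rintro f g ⟨hf, K, hK, hfK⟩ ⟨hg, L, hL, hgL⟩
    refine ⟨fun z e => ?_, K ∪ L, hK.union hL, fun e he => ?_⟩
    · simp only [ContinuousMap.add_apply, hf z e, hg z e, mul_add]
    · rw [Set.mem_union, not_or] at he
      simp [hfK e he.1, hgL e he.2]
  smul_mem' := by
    rintro c f ⟨hf, K, hK, hfK⟩
    refine ⟨fun z e => ?_, K, hK, fun e he => by simp [hfK e he]⟩
    simp only [ContinuousMap.smul_apply, hf z e, smul_eq_mul]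
    ring

/-- `C₀(G; E)`: the continuous equivariant functions on `E` whose absolute value, seen as a
function on `G`, vanishes at infinity; with the supremum norm.  (Such functions are automatically
bounded.) -/
def CZero : Submodule ℂ (E →ᵇ ℂ) where
  carrier := {f | T.IsEquivariant f ∧ Tendsto f (comap T.q (cocompact G)) (𝓝 0)}
  zero_mem' := ⟨fun z e => by simp, tendsto_const_nhds⟩
  add_mem' := by
    rintro f g ⟨hf, hf0⟩ ⟨hg, hg0⟩
    refine ⟨fun z e => ?_, ?_⟩
    · simp only [BoundedContinuousFunction.add_apply, hf z e, hg z e, mul_add]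
    · have h := hf0.add hg0
      rw [add_zero] at h
      exact h
  smul_mem' := by
    rintro c f ⟨hf, hf0⟩
    refine ⟨fun z e => ?_, ?_⟩
    · simp only [BoundedContinuousFunction.smul_apply, hf z e, smul_eq_mul]
      ring
    · have h := hf0.const_smul c
      rw [smul_zero] at h
      exact h

/-- The equivariant (not necessarily continuous) functions `ξ` on `E` for which `|ξ|²`, seen as a
function on `G`, is summable. -/
noncomputable def l2Submodule : Submodule ℂ (E → ℂ) where
  carrier := {ξ | T.IsEquivariant ξ ∧ Memℓp (fun γ => ξ (T.lift γ)) 2}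
  zero_mem' := ⟨fun z e => by simp, zero_memℓp⟩
  add_mem' := by
    rintro f g ⟨hf, hf2⟩ ⟨hg, hg2⟩
    refine ⟨fun z e => ?_, hf2.add hg2⟩
    simp only [Pi.add_apply, hf z e, hg z e, mul_add]
  smul_mem' := by
    rintro c f ⟨hf, hf2⟩
    refine ⟨fun z e => ?_, hf2.const_smul c⟩
    simp only [Pi.smul_apply, hf z e, smul_eq_mul]
    ring

/-- The Hilbert space `ℓ²(G; E)` of square-summable equivariant functions on `E`, with
`⟪ξ, η⟫ = ∑_{q(e) ∈ G} conj (ξ e) * η e` (the terms depend on `q(e)` only).  It is the Hilbert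
space direct sum, over the units `u` of `G`, of the spaces `ℓ²(G_u; E)` on which the regular
representations of `C_c(G; E)` act. -/
def L2 : Type _ := ↥T.l2Submodule

namespace L2

variable {T}

noncomputable instance : AddCommGroup T.L2 := inferInstanceAs (AddCommGroup T.l2Submodule)

noncomputable instance : Module ℂ T.L2 := inferInstanceAs (Module ℂ T.l2Submodule)

instance : CoeFun T.L2 fun _ => E → ℂ := ⟨fun ξ => ξ.1⟩

variable (T) in
/-- Evaluation at the chosen points of the fibres of `q`. -/
noncomputable def toLp : T.L2 →ₗ[ℂ] lp (fun _ : G => ℂ) 2 where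
  toFun ξ := ⟨fun γ => ξ (T.lift γ), ξ.2.2⟩
  map_add' _ _ := rfl
  map_smul' _ _ := rfl

theorem toLp_apply (ξ : T.L2) (γ : G) : toLp T ξ γ = ξ (T.lift γ) := rfl

theorem toLp_injective : Function.Injective (toLp T) := by
  intro ξ η h
  apply Subtype.ext
  funext e
  obtain ⟨z, hz⟩ := exists_act (T.q_lift (T.q e))
  have h1 := congrArg (fun a : lp (fun _ : G => ℂ) 2 => a (T.q e)) h
  simp only [toLp_apply] at h1
  rw [← hz]
  exact (ξ.2.1 z _).trans ((congrArg (fun c : ℂ => (z : ℂ) * c) h1).trans (η.2.1 z _).symm)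

theorem toLp_surjective : Function.Surjective (toLp T) := by
  intro a
  choose p hp using fun e : E => exists_act (T := T) (T.q_lift (T.q e))
  have hp1 : ∀ γ, p (T.lift γ) = 1 := by
    intro γ
    apply act_injective (T := T) (T.lift γ)
    have h := hp (T.lift γ)
    rw [T.q_lift] at h
    change T.act _ _ = T.act _ _
    rw [h, act, ← r_eq_ι, r_mul_self]
  have hpz : ∀ z e, p (T.act z e) = z * p e := by
    intro z e
    apply act_injective (T := T) (T.lift (T.q e))
    change T.act _ _ = T.act _ _
    rw [← act_act, hp e]
    have h := hp (T.act z e)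
    rwa [q_act] at h
  refine ⟨⟨fun e => (p e : ℂ) * a (T.q e), fun z e => ?_, ?_⟩, ?_⟩
  · change (p (T.act z e) : ℂ) * a (T.q (T.act z e)) = z * (p e * a (T.q e))
    rw [hpz, q_act, Circle.coe_mul, mul_assoc]
  · have : (fun γ => (p (T.lift γ) : ℂ) * a (T.q (T.lift γ))) = fun γ => a γ := by
      funext γ
      rw [hp1, T.q_lift, Circle.coe_one, one_mul]
    rw [this]
    exact a.2
  · apply Subtype.ext
    funext γ
    change (p (T.lift γ) : ℂ) * a (T.q (T.lift γ)) = a γ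
    rw [hp1, T.q_lift, Circle.coe_one, one_mul]

noncomputable instance : NormedAddCommGroup T.L2 :=
  NormedAddCommGroup.induced T.L2 (lp (fun _ : G => ℂ) 2) (toLp T) toLp_injective

noncomputable instance : InnerProductSpace ℂ T.L2 :=
  { NormedSpace.induced ℂ T.L2 (lp (fun _ : G => ℂ) 2) (toLp T) with
    inner := fun ξ η => inner ℂ (toLp T ξ) (toLp T η)
    norm_sq_eq_re_inner := fun ξ => norm_sq_eq_re_inner (𝕜 := ℂ) (toLp T ξ)
    conj_inner_symm := fun ξ η => inner_conj_symm (toLp T ξ) (toLp T η)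
    add_left := fun ξ η ζ => by rw [map_add, inner_add_left]
    smul_left := fun ξ η c => by rw [map_smul, inner_smul_left] }

theorem norm_toLp (ξ : T.L2) : ‖toLp T ξ‖ = ‖ξ‖ := rfl

noncomputable instance : CompleteSpace T.L2 := by
  have hi : Isometry (toLp T) := AddMonoidHomClass.isometry_of_norm _ norm_toLp
  refine (completeSpace_iff_isComplete_range hi.isUniformInducing).2 ?_
  rw [toLp_surjective.range_eq]
  exact isClosed_univ.isComplete

end L2

/-! The regular representation -/

/-- The function `e ↦ ∑_{q(e₁) ∈ G^{r(e)}} f(e₁) ξ(e₁⁻¹ e)`, whose terms depend on `q(e₁)` only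
when `f` and `ξ` are equivariant.  For `f ∈ C_c(G; E)` the sum is finite. -/
noncomputable def conv (f ξ : E → ℂ) (e : E) : ℂ :=
  ∑' η : {η : G // r η = r (T.q e)}, f (T.lift η) * ξ ((T.lift η)⁻¹ * e)

section Bound

variable {T}

theorem r_lift {e : E} (η : {η : G // r η = r (T.q e)}) : r (T.lift η.1) = r e :=
  (r_eq_iff (T := T)).2 (by rw [T.q_lift, η.2])

theorem conv_act {f ξ : E → ℂ} (hξ : T.IsEquivariant ξ) (z : Circle) (e : E) :
    T.conv f ξ (T.act z e) = z * T.conv f ξ e := by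
  unfold conv
  rw [q_act, ← tsum_mul_left]
  refine tsum_congr fun η => ?_
  rw [inv_mul_act (r_lift η), hξ]
  ring

theorem exists_norm_le (f : T.Cc) : ∃ C : ℝ, ∀ e, ‖f.1 e‖ ≤ C := by
  obtain ⟨f, hf, K, hK, hfK⟩ := f
  have hc : Continuous fun γ : G => ‖f (T.lift γ)‖ := by
    rw [(T.isOpenMap_q.isQuotientMap T.continuous_q T.surjective_q).continuous_iff]
    have : (fun γ : G => ‖f (T.lift γ)‖) ∘ T.q = fun e => ‖f e‖ := by
      funext e
      exact hf.norm_eq (T.q_lift _)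
    rw [this]
    exact f.continuous.norm
  obtain ⟨C, hC⟩ := hK.exists_bound_of_continuousOn hc.continuousOn
  refine ⟨max C 0, fun e => ?_⟩
  by_cases he : T.q e ∈ K
  · refine le_trans ?_ (le_max_left C 0)
    have := hC _ he
    rwa [norm_norm, hf.norm_eq (T.q_lift _)] at this
  · simp [hfK e he]

variable [IsEtale G]

theorem finite_support_conv (f : T.Cc) (ξ : E → ℂ) (e : E) :
    (Function.support fun η : {η : G // r η = r (T.q e)} =>
      f.1 (T.lift η) * ξ ((T.lift η)⁻¹ * e)).Finite := by
  obtain ⟨f, hf, K, hK, hfK⟩ := f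
  obtain ⟨N, hN⟩ := exists_card_le_range hK
  by_contra hinf
  obtain ⟨A, hA, hcard⟩ := Set.Infinite.exists_subset_card_eq hinf (N + 1)
  have := hN (r (T.q e)) (A.map (Function.Embedding.subtype _)) fun x hx => by
    obtain ⟨η, hη, rfl⟩ := Finset.mem_map.1 hx
    refine ⟨?_, η.2⟩
    by_contra hnK
    refine hA hη ?_
    change f (T.lift η) * _ = 0
    rw [hfK _ (by rwa [T.q_lift]), zero_mul]
  rw [Finset.card_map] at this
  omega

theorem exists_l2_bound (f : T.Cc) : ∃ M : ℝ, 0 ≤ M ∧ ∀ (ξ : T.L2) (A : Finset G),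
    ∑ γ ∈ A, ‖T.conv f.1 ξ (T.lift γ)‖ ^ 2 ≤ M ^ 2 * ‖ξ‖ ^ 2 := by
  classical
  obtain ⟨C, hC⟩ := exists_norm_le f
  obtain ⟨K, hK, hfK⟩ := f.2.2
  obtain ⟨N₁, hN₁⟩ := exists_card_le_range hK
  obtain ⟨N₂, hN₂⟩ := exists_card_le_source hK
  refine ⟨√(N₁ * N₂) * |C|, by positivity, fun ξ A => ?_⟩
  set X : G → ℝ≥0∞ := fun κ => ENNReal.ofReal (‖ξ (T.lift κ)‖ ^ 2) with hX
  have hq : ∀ γ η : G, r η = r γ → T.q ((T.lift η)⁻¹ * T.lift γ) = η⁻¹ * γ := by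
    intro γ η h
    have h1 : r (T.lift η) = r (T.lift γ) := (r_eq_iff (T := T)).2 (by rw [T.q_lift, T.q_lift, h])
    rw [T.q_mul _ _ ((s_inv' _).trans h1), q_inv, T.q_lift, T.q_lift]
  -- pointwise estimate
  have step1 : ∀ γ, ENNReal.ofReal (‖T.conv f.1 ξ (T.lift γ)‖ ^ 2) ≤
      ENNReal.ofReal (N₁ * C ^ 2) *
        ∑' η : G, (if η ∈ K ∧ r η = r γ then X (η⁻¹ * γ) else 0) := by
    intro γ
    have hfin := finite_support_conv f ξ.1 (T.lift γ)
    set S := hfin.toFinset with hS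
    have hSK : ∀ η ∈ S, η.1 ∈ K := by
      intro η hη
      by_contra hn
      have h0 := hfin.mem_toFinset.1 hη
      refine h0 ?_
      change f.1 (T.lift η) * _ = 0
      rw [hfK _ (by rwa [T.q_lift]), zero_mul]
    have hSr : ∀ η : {η : G // r η = r (T.q (T.lift γ))}, r η.1 = r γ := fun η => by
      rw [η.2, T.q_lift]
    have hcard : S.card ≤ N₁ := by
      have := hN₁ (r γ) (S.map (Function.Embedding.subtype _)) fun x hx => by
        obtain ⟨η, hη, rfl⟩ := Finset.mem_map.1 hx
        exact ⟨hSK η hη, hSr η⟩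
      rwa [Finset.card_map] at this
    have hsum : T.conv f.1 ξ (T.lift γ) =
        ∑ η ∈ S, f.1 (T.lift η) * ξ ((T.lift η)⁻¹ * T.lift γ) := by
      refine tsum_eq_sum fun η hη => ?_
      by_contra hne
      exact hη (hfin.mem_toFinset.2 hne)
    have hreal : ‖T.conv f.1 ξ (T.lift γ)‖ ^ 2 ≤
        N₁ * C ^ 2 * ∑ η ∈ S, ‖ξ (T.lift (η.1⁻¹ * γ))‖ ^ 2 := by
      calc ‖T.conv f.1 ξ (T.lift γ)‖ ^ 2
          ≤ (∑ η ∈ S, ‖f.1 (T.lift η) * ξ ((T.lift η)⁻¹ * T.lift γ)‖) ^ 2 := by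
            rw [hsum]
            gcongr
            exact norm_sum_le _ _
        _ ≤ S.card * ∑ η ∈ S, ‖f.1 (T.lift η) * ξ ((T.lift η)⁻¹ * T.lift γ)‖ ^ 2 :=
            sq_sum_le_card_mul_sum_sq
        _ ≤ N₁ * ∑ η ∈ S, C ^ 2 * ‖ξ (T.lift (η.1⁻¹ * γ))‖ ^ 2 := by
            refine mul_le_mul (by exact_mod_cast hcard) (Finset.sum_le_sum fun η _ => ?_)
              (Finset.sum_nonneg fun η _ => by positivity) (by positivity)
            rw [norm_mul, mul_pow, ξ.2.1.norm_eq ((hq γ η (hSr η)).trans (T.q_lift _).symm)]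
            gcongr
            exact hC _
        _ = _ := by rw [← Finset.mul_sum, mul_assoc]
    refine (ENNReal.ofReal_le_ofReal hreal).trans ?_
    rw [ENNReal.ofReal_mul (by positivity), ENNReal.ofReal_sum_of_nonneg fun _ _ => by positivity]
    gcongr
    calc ∑ η ∈ S, ENNReal.ofReal (‖ξ (T.lift (η.1⁻¹ * γ))‖ ^ 2)
        = ∑ η ∈ S.map (Function.Embedding.subtype _),
            (if η ∈ K ∧ r η = r γ then X (η⁻¹ * γ) else 0) := by
          rw [Finset.sum_map]
          refine Finset.sum_congr rfl fun η hη => ?_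
          exact (if_pos ⟨hSK η hη, hSr η⟩).symm
      _ ≤ _ := ENNReal.sum_le_tsum _
  -- change of variables
  have step2 : ∀ η : G, ∑' γ : G, (if η ∈ K ∧ r η = r γ then X (η⁻¹ * γ) else 0) ≤
      ∑' κ : G, (if η ∈ K ∧ s η = r κ then X κ else 0) := by
    intro η
    have h1 : ∑' γ : G, (if η ∈ K ∧ r η = r γ then X (η⁻¹ * γ) else 0) =
        ∑' γ : {γ : G | r η = r γ},
          (fun κ : G => if η ∈ K ∧ s η = r κ then X κ else 0) (η⁻¹ * γ) := by
      rw [tsum_subtype {γ : G | r η = r γ}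
        (fun γ => (fun κ : G => if η ∈ K ∧ s η = r κ then X κ else 0) (η⁻¹ * γ))]
      refine tsum_congr fun γ => ?_
      by_cases hγ : r η = r γ
      · have hr : r (η⁻¹ * γ) = s η := by rw [r_mul' _ _ ((s_inv' _).trans hγ), r_inv']
        rw [Set.indicator_of_mem (show γ ∈ {γ : G | r η = r γ} from hγ)]
        simp only [hγ, hr, and_true]
      · rw [Set.indicator_of_notMem (show γ ∉ {γ : G | r η = r γ} from hγ)]
        simp only [hγ, and_false, if_false]
    rw [h1]
    refine ENNReal.tsum_comp_le_tsum_of_injective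
      (f := fun γ : {γ : G | r η = r γ} => η⁻¹ * γ.1) ?_ _
    intro γ γ' h
    apply Subtype.ext
    have h2 : η * (η⁻¹ * γ.1) = η * (η⁻¹ * γ'.1) := congrArg (η * ·) h
    rwa [mul_inv_cancel_left' γ.2, mul_inv_cancel_left' γ'.2] at h2
  have step3 : ∀ κ : G, ∑' η : G, (if η ∈ K ∧ s η = r κ then X κ else 0) ≤ N₂ * X κ := by
    intro κ
    rw [ENNReal.tsum_eq_iSup_sum]
    refine iSup_le fun B => ?_
    rw [← Finset.sum_filter, Finset.sum_const, nsmul_eq_mul]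
    gcongr
    refine hN₂ (r κ) _ fun x hx => (Finset.mem_filter.1 hx).2
  have step4 : ∑' κ, X κ = ENNReal.ofReal (‖ξ‖ ^ 2) := by
    have h := lp.norm_rpow_eq_tsum (p := 2) (by norm_num) (L2.toLp T ξ)
    have hs := (lp.memℓp (L2.toLp T ξ)).summable (by norm_num)
    simp only [ENNReal.toReal_ofNat, Real.rpow_ofNat] at h hs
    rw [← L2.norm_toLp, h, ENNReal.ofReal_tsum_of_nonneg (fun _ => by positivity) hs]
    rfl
  have key : ∑' γ, ENNReal.ofReal (‖T.conv f.1 ξ (T.lift γ)‖ ^ 2) ≤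
      ENNReal.ofReal (N₁ * C ^ 2) * (N₂ * ENNReal.ofReal (‖ξ‖ ^ 2)) := by
    refine (ENNReal.tsum_le_tsum step1).trans ?_
    rw [ENNReal.tsum_mul_left]
    gcongr
    rw [ENNReal.tsum_comm]
    refine (ENNReal.tsum_le_tsum step2).trans ?_
    rw [ENNReal.tsum_comm]
    refine (ENNReal.tsum_le_tsum step3).trans ?_
    rw [ENNReal.tsum_mul_left, step4]
  have h := (ENNReal.sum_le_tsum A).trans key
  rw [← ENNReal.ofReal_sum_of_nonneg fun _ _ => by positivity, ← ENNReal.ofReal_natCast N₂,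
    ← ENNReal.ofReal_mul (by positivity), ← ENNReal.ofReal_mul (by positivity),
    ENNReal.ofReal_le_ofReal_iff (by positivity)] at h
  refine h.trans (le_of_eq ?_)
  rw [mul_pow, Real.sq_sqrt (by positivity), sq_abs]
  ring

end Bound

variable [IsEtale G]

/-- The left regular representation of `C_c(G; E)` on `ℓ²(G; E)`, that is, the direct sum over the
units of `G` of the regular representations: `f` acts by `ξ ↦ f * ξ`. -/
noncomputable def leftRegular (f : T.Cc) : T.L2 →L[ℂ] T.L2 :=
  LinearMap.mkContinuousOfExistsBound
    { toFun := fun ξ => ⟨T.conv f.1 ξ, fun z e => conv_act ξ.2.1 z e, by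
        obtain ⟨M, -, hM⟩ := exists_l2_bound f
        exact memℓp_gen' (C := M ^ 2 * ‖ξ‖ ^ 2) fun A => by simpa using hM ξ A⟩
      map_add' := fun ξ η => by
        apply Subtype.ext
        funext e
        change T.conv f.1 (ξ.1 + η.1) e = T.conv f.1 ξ.1 e + T.conv f.1 η.1 e
        unfold conv
        rw [← Summable.tsum_add
          (summable_of_hasFiniteSupport (finite_support_conv f ξ.1 e))
          (summable_of_hasFiniteSupport (finite_support_conv f η.1 e))]
        refine tsum_congr fun x => ?_
        rw [Pi.add_apply, mul_add]
      map_smul' := fun c ξ => by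
        apply Subtype.ext
        funext e
        change T.conv f.1 (c • ξ.1) e = c • T.conv f.1 ξ.1 e
        unfold conv
        rw [smul_eq_mul, ← tsum_mul_left]
        refine tsum_congr fun x => ?_
        rw [Pi.smul_apply, smul_eq_mul]
        ring }
    (by
      obtain ⟨M, hM0, hM⟩ := exists_l2_bound f
      refine ⟨M, fun ξ => ?_⟩
      rw [← L2.norm_toLp]
      refine lp.norm_le_of_forall_sum_le (by norm_num) (by positivity) fun A => ?_
      have := hM ξ A
      rw [← mul_pow] at this
      simp only [ENNReal.toReal_ofNat, Real.rpow_ofNat]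
      exact this)

theorem leftRegular_apply (f : T.Cc) (ξ : T.L2) (e : E) :
    T.leftRegular f ξ e = T.conv f.1 ξ e := rfl

/-- The reduced `C*`-algebra `C*_r(G; E)`: the `C*`-algebra of operators on `ℓ²(G; E)` generated
by the image of `C_c(G; E)` under the regular representation. -/
noncomputable def reducedCStar : NonUnitalStarSubalgebra ℂ (T.L2 →L[ℂ] T.L2) :=
  (NonUnitalStarAlgebra.adjoin ℂ (Set.range T.leftRegular)).topologicalClosure

/-- An element of `C_c(G; E)`, viewed in the reduced `C*`-algebra. -/
noncomputable def toReduced (f : T.Cc) : T.reducedCStar :=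
  ⟨T.leftRegular f, subset_closure (NonUnitalStarAlgebra.subset_adjoin ℂ _ ⟨f, rfl⟩)⟩

end GroupoidTwist

/-! The map is given by matrix coefficients: `j a e = ⟪δ_e, a δ_{s(e)}⟫`, where `δ_e` is the
equivariant point mass on the orbit of `e`. Point masses are unit vectors, so `|j a e| ≤ ‖a‖`, and
for `a = λ(f)` the coefficient is `f e` (`coeff_leftRegular`).

The étale hypothesis makes convolution on `C_c(G; E)` a finite sum over local sections, hence
continuous (`continuous_tsum_fiber`). So `λ(C_c(G; E))` is already a `*`-algebra, and it is dense in
the reduced algebra (`reducedCStar_subset_closure`). By the norm bound, every `j a` is a uniform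
limit of functions in `C_c(G; E)`, which puts it in `C₀(G; E)`.

The algebraic claims rest on right invariance (`IsRightInvariant`): the coefficient of `a δ_{e₀}` at
`e` is `j a (e e₀⁻¹)` when the sources agree, and zero otherwise. This holds for `λ(f)` and is a
closed condition, so it holds on the whole reduced algebra. Thus `j a` determines all matrix
coefficients of `a`, which gives injectivity. Combined with the coefficients of an adjoint, it gives
the formula for `a*`. Expanding `⟪a* δ_{e'}, b δ_{s(e')}⟫` as a sum over `G` gives the convolution
formula. -/

namespace ArrowGroupoid

/-! ### Cancellation laws in a groupoid -/

section Algebra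

variable {G : Type*} [ArrowGroupoid G]

theorem s_inv_s (x : G) : (s x)⁻¹ = s x := by
  have h : s x * s x = r (s x) := by
    have h := r_mul_self (s x)
    rw [r_s] at h
    rw [h, r_s]
  exact (eq_inv_of_mul (by rw [s_s, r_s]) h).symm

theorem s_mul_inv (x : G) : s x * x⁻¹ = x⁻¹ := by
  rw [← r_inv', r_mul_self]

theorem inv_mul_cancel_right' {x y : G} (h : s x = s y) : x * y⁻¹ * y = x := by
  rw [mul_assoc' _ _ _ (h.trans (r_inv' y).symm) (s_inv' y), inv_mul', ← h, mul_s_self]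

theorem mul_inv_cancel_right' {x y : G} (h : s x = r y) : x * y * y⁻¹ = x := by
  rw [mul_assoc' _ _ _ h (r_inv' y).symm, mul_inv', ← h, mul_s_self]

theorem mul_inv_rev' {x y : G} (h : s x = r y) : (x * y)⁻¹ = y⁻¹ * x⁻¹ := by
  have h1 : s y⁻¹ = r x⁻¹ := by rw [s_inv', r_inv', h]
  refine (eq_inv_of_mul ?_ ?_).symm
  · rw [s_mul' _ _ h, r_mul' _ _ h1, r_inv']
  · rw [← mul_assoc' _ _ _ (by rw [s_mul' _ _ h, r_inv']) h1, mul_inv_cancel_right' h, mul_inv',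
      r_mul' _ _ h]

end Algebra

/-! ### Compactness of products and continuity of sums over range fibres -/

section Topology

variable {G : Type*} [TopologicalSpace G] [ArrowGroupoid G]

theorem continuous_r [IsTopological G] : Continuous (r : G → G) := by
  have h : (r : G → G) = (fun p : {p : G × G // s p.1 = r p.2} => p.1.1 * p.1.2) ∘
      fun x => ⟨(x, x⁻¹), (r_inv' x).symm⟩ := by
    funext x
    exact (mul_inv' x).symm
  rw [h]
  exact IsTopological.continuous_mul.comp
    ((continuous_id.prodMk IsTopological.continuous_inv).subtype_mk _)

theorem continuous_s [IsTopological G] : Continuous (s : G → G) := by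
  have h : (s : G → G) = r ∘ fun x => x⁻¹ := by
    funext x
    exact (r_inv' x).symm
  rw [h]
  exact continuous_r.comp IsTopological.continuous_inv

/-- The set of products of elements of two compact sets is contained in a compact set. -/
theorem exists_compact_mul [IsTopological G] [T2Space G] {K L : Set G} (hK : IsCompact K)
    (hL : IsCompact L) : ∃ M : Set G, IsCompact M ∧
      ∀ x ∈ K, ∀ y ∈ L, s x = r y → x * y ∈ M := by
  have hcl : IsClosed {p : G × G | s p.1 = r p.2} :=
    isClosed_eq (continuous_s.comp continuous_fst) (continuous_r.comp continuous_snd)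
  have hc : IsCompact ((Subtype.val : {p : G × G // s p.1 = r p.2} → G × G) ⁻¹' (K ×ˢ L)) :=
    hcl.isClosedEmbedding_subtypeVal.isCompact_preimage (hK.prod hL)
  exact ⟨_, hc.image IsTopological.continuous_mul,
    fun x hx y hy h => ⟨⟨(x, y), h⟩, ⟨hx, hy⟩, rfl⟩⟩

/-- Summation over the fibres of the range map of an étale groupoid preserves continuity, for
functions supported over a compact set. -/
theorem continuous_tsum_fiber [IsEtale G] [T2Space G] {Y : Type*} [TopologicalSpace Y]
    {ρ : Y → units G} (hρ : Continuous ρ) {F : G → Y → ℂ}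
    (hF : ContinuousOn (fun p : G × Y => F p.1 p.2) {p | r p.1 = ρ p.2})
    {K : Set G} (hK : IsCompact K) (hFK : ∀ x ∉ K, ∀ y, F x y = 0) :
    Continuous fun y => ∑' x : {x : G // r x = ρ y}, F x y := by
  classical
  rw [continuous_iff_continuousAt]
  intro y₀
  -- The fibre over `ρ y₀` meets `K` in finitely many points. Through each runs a local section of
  -- the range map; near `y₀` the sum becomes a finite sum along these sections.
  have hfin : {x : G | x ∈ K ∧ r x = ρ y₀}.Finite := by
    obtain ⟨N, hN⟩ := exists_card_le_range hK
    by_contra hinf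
    obtain ⟨A, hA, hcard⟩ := Set.Infinite.exists_subset_card_eq hinf (N + 1)
    have := hN (ρ y₀) A fun x hx => hA hx
    omega
  -- Disjoint neighbourhoods keep sections through different points apart, so no term is counted
  -- twice.
  obtain ⟨V, hV, hVd⟩ := hfin.t2_separation
  choose φ hφx hφ using IsEtale.isLocalHomeomorph_range (G := G)
  set A := hfin.toFinset with hA
  have hAmem : ∀ {x}, x ∈ A ↔ x ∈ K ∧ r x = ρ y₀ := fun {x} => hfin.mem_toFinset
  have hAy : ∀ x ∈ A, φ x x = ρ y₀ := fun x hx => by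
    rw [← congrFun (hφ x) x]
    exact Subtype.ext (hAmem.1 hx).2
  set σ : G → Y → G := fun x y => (φ x).symm (ρ y) with hσ
  have hσ0 : ∀ x ∈ A, σ x y₀ = x := fun x hx => by
    rw [hσ]
    change (φ x).symm (ρ y₀) = x
    rw [← hAy x hx, (φ x).left_inv (hφx x)]
  have htgt : ∀ x ∈ A, ρ y₀ ∈ (φ x).target := fun x hx => by
    rw [← hAy x hx]
    exact (φ x).map_source (hφx x)
  have hσc : ∀ x ∈ A, Tendsto (σ x) (𝓝 y₀) (𝓝 x) := fun x hx => by
    have h := ((φ x).continuousAt_symm (htgt x hx)).tendsto.comp hρ.continuousAt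
    change Tendsto (σ x) (𝓝 y₀) (𝓝 (σ x y₀)) at h
    rwa [hσ0 x hx] at h
  have hσr : ∀ x ∈ A, ∀ᶠ y in 𝓝 y₀, r (σ x y) = ρ y := fun x hx => by
    filter_upwards [hρ.continuousAt.eventually ((φ x).open_target.mem_nhds (htgt x hx))] with y hy
    have h := (φ x).right_inv hy
    rw [← congrFun (hφ x)] at h
    exact congrArg Subtype.val h
  have hσV : ∀ x ∈ A, ∀ᶠ y in 𝓝 y₀, σ x y ∈ V x := fun x hx =>
    (hσc x hx).eventually ((hV x).2.mem_nhds (hV x).1)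
  -- near `y₀`, the part of the fibre in `K` is covered by the local sections
  have hcov : ∀ᶠ y in 𝓝 y₀, ∀ x ∈ K, r x = ρ y → ∃ a ∈ A, x = σ a y := by
    -- No new point of `K` can enter a nearby fibre outside the charts: `r '' (K \ W)` is compact,
    -- hence closed, and misses `ρ y₀`.
    set W : Set G := ⋃ a ∈ A, (φ a).source with hW
    have hWo : IsOpen W := isOpen_biUnion fun a _ => (φ a).open_source
    have hcl : IsClosed (r '' (K \ W)) := ((hK.diff hWo).image continuous_r).isClosed
    have hmem : (ρ y₀ : G) ∈ (r '' (K \ W))ᶜ := by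
      rintro ⟨x, ⟨hxK, hxW⟩, hx⟩
      exact hxW (Set.mem_biUnion (Finset.mem_coe.2 (hAmem.2 ⟨hxK, hx⟩)) (hφx x))
    have hev := (continuous_subtype_val.comp hρ).continuousAt.eventually
      (hcl.isOpen_compl.mem_nhds hmem)
    filter_upwards [hev] with y hy x hxK hx
    have hxW : x ∈ W := by
      by_contra hn
      exact hy ⟨x, ⟨hxK, hn⟩, hx⟩
    obtain ⟨a, ha, hxa⟩ := Set.mem_iUnion₂.1 hxW
    refine ⟨a, ha, ?_⟩
    have h1 : φ a x = ρ y := by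
      rw [← congrFun (hφ a) x]
      exact Subtype.ext hx
    change x = (φ a).symm (ρ y)
    rw [← h1, (φ a).left_inv hxa]
  have hsum : ∀ᶠ y in 𝓝 y₀,
      ∑' x : {x : G // r x = ρ y}, F x y = ∑ a ∈ A, F (σ a y) y := by
    filter_upwards [hcov, (Finset.eventually_all A).2 hσr, (Finset.eventually_all A).2 hσV]
      with y h1 h2 h3
    have hinj : Set.InjOn (fun a => σ a y) A := by
      intro a ha b hb hab
      by_contra hne
      refine (hVd (hAmem.1 ha) (hAmem.1 hb) hne).le_bot ⟨h3 a ha, ?_⟩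
      change σ a y = σ b y at hab
      rw [hab]
      exact h3 b hb
    rw [← Finset.sum_image (f := fun x => F x y) hinj]
    refine (tsum_subtype {x : G | r x = ρ y} fun x => F x y).trans ?_
    -- A section may leave `K`, which is harmless since it stays in the fibre. Only the converse
    -- matters: fibre points off the sections lie outside `K` and contribute zero.
    rw [tsum_eq_sum (s := A.image fun a => σ a y)]
    · refine Finset.sum_congr rfl fun x hx => ?_
      obtain ⟨a, ha, rfl⟩ := Finset.mem_image.1 hx
      exact Set.indicator_of_mem (show σ a y ∈ {x : G | r x = ρ y} from h2 a ha) _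
    · intro x hx
      by_cases hxr : x ∈ {x : G | r x = ρ y}
      · rw [Set.indicator_of_mem hxr]
        refine hFK x (fun hxK => hx ?_) y
        obtain ⟨a, ha, rfl⟩ := h1 x hxK hxr
        exact Finset.mem_image_of_mem _ ha
      · exact Set.indicator_of_notMem hxr _
  rw [ContinuousAt, hsum.self_of_nhds]
  refine Tendsto.congr' (EventuallyEq.symm hsum) (tendsto_finsetSum _ fun a ha => ?_)
  have h0 : (a, y₀) ∈ {p : G × Y | r p.1 = ρ p.2} := (hAmem.1 ha).2
  have hlim : Tendsto (fun y => (σ a y, y)) (𝓝 y₀)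
      (𝓝[{p : G × Y | r p.1 = ρ p.2}] (a, y₀)) :=
    tendsto_nhdsWithin_iff.2 ⟨(hσc a ha).prodMk_nhds tendsto_id, hσr a ha⟩
  have h := (hF (a, y₀) h0).tendsto.comp hlim
  rw [hσ0 a ha]
  exact h

end Topology

end ArrowGroupoid

namespace GroupoidTwist

variable {G E : Type*} [TopologicalSpace G] [ArrowGroupoid G] [TopologicalSpace E]
  [ArrowGroupoid E] {T : GroupoidTwist G E}

/-! The circle action and the groupoid operations -/

theorem act_one (e : E) : T.act 1 e = e := by
  rw [act, ← r_eq_ι, r_mul_self]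

theorem s_act (z : Circle) (e : E) : s (T.act z e) = s e :=
  (s_eq_iff (T := T)).2 (by rw [q_act])

theorem act_mul {e f : E} (h : s e = r f) (z : Circle) : T.act z (e * f) = T.act z e * f := by
  have hu : rangeUnit (T.q (e * f)) = rangeUnit (T.q e) := by
    apply Subtype.ext
    change r (T.q (e * f)) = r (T.q e)
    rw [← T.q_r, ← T.q_r, r_mul' _ _ h]
  rw [act, hu, ← mul_assoc' _ _ _ (s_ι_eq_r e z) h, act]

/-- Inversion turns the action of `z` into that of `z⁻¹`; acting once more by `z` avoids naming the
inverse. The proof writes `f = e (e⁻¹ f)` and moves `z` across the product onto `e`. -/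
theorem act_act_inv_mul {e f : E} (h : r e = r f) (z : Circle) :
    T.act z ((T.act z e)⁻¹ * f) = e⁻¹ * f := by
  have hc : s e = r (e⁻¹ * f) := by rw [r_mul' _ _ ((s_inv' e).trans h), r_inv']
  conv_lhs => rw [← mul_inv_cancel_left' h]
  rw [← inv_mul_act (by rw [r_act, r_mul' _ _ hc]), act_mul hc,
    inv_mul_cancel_left' (by rw [s_act, hc])]

theorem act_act_inv (z : Circle) (e : E) : T.act z (T.act z e)⁻¹ = e⁻¹ := by
  have h := act_act_inv_mul (T := T) (e := e) (f := r e) (r_r e).symm z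
  have h1 : (T.act z e)⁻¹ * r e = (T.act z e)⁻¹ := by
    rw [← r_act (T := T) z e, ← s_inv', mul_s_self]
  have h2 : e⁻¹ * r e = e⁻¹ := by rw [← s_inv', mul_s_self]
  rwa [h1, h2] at h

/-- The terms of the convolution product depend on points of `G` only. -/
theorem mul_inv_mul_eq {f ξ : E → ℂ} (hf : T.IsEquivariant f) (hξ : T.IsEquivariant ξ)
    {x y e : E} (hxy : T.q x = T.q y) (h : r x = r e) :
    f x * ξ (x⁻¹ * e) = f y * ξ (y⁻¹ * e) := by
  obtain ⟨z, rfl⟩ := exists_act hxy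
  rw [hf z, ← act_act_inv_mul (T := T) h z, hξ z]
  ring

/-- Inversion replaces the phase `z` by `z⁻¹`, and conjugation restores it. -/
theorem IsEquivariant.star_inv {f : E → ℂ} (hf : T.IsEquivariant f) :
    T.IsEquivariant fun e => conj (f e⁻¹) := by
  intro z e
  have h : f e⁻¹ = z * f (T.act z e)⁻¹ := by rw [← hf z, act_act_inv]
  have hz : (z : ℂ) * conj (z : ℂ) = 1 := by
    rw [← Circle.coe_inv_eq_conj, ← Circle.coe_mul, mul_inv_cancel, Circle.coe_one]
  change conj (f _) = z * conj (f e⁻¹)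
  rw [h, map_mul, ← mul_assoc, hz, one_mul]

/-! Point masses -/

open Classical in
/-- The equivariant function with value `z` at `z · e` that vanishes off the orbit of `e`. -/
noncomputable def deltaFun (T : GroupoidTwist G E) (e x : E) : ℂ :=
  if h : T.q e = T.q x then ((exists_act h).choose : ℂ) else 0

/-- The circle acts freely, so the chosen phase is the only possible one. -/
theorem deltaFun_act_self (e : E) (z : Circle) : T.deltaFun e (T.act z e) = z := by
  have h : T.q e = T.q (T.act z e) := (q_act z e).symm
  rw [deltaFun, dif_pos h]
  exact congrArg _ (act_injective e (exists_act h).choose_spec)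

theorem deltaFun_of_ne {e x : E} (h : T.q e ≠ T.q x) : T.deltaFun e x = 0 := dif_neg h

theorem isEquivariant_deltaFun (e : E) : T.IsEquivariant (T.deltaFun e) := by
  intro z x
  by_cases h : T.q e = T.q x
  · obtain ⟨w, rfl⟩ := exists_act h
    rw [act_act, deltaFun_act_self, deltaFun_act_self, Circle.coe_mul]
  · rw [deltaFun_of_ne h, deltaFun_of_ne (by rwa [q_act]), mul_zero]

variable (T) in
/-- The function `deltaFun e`, as a unit vector of `ℓ²(G; E)`. -/
noncomputable def delta (e : E) : T.L2 :=
  ⟨T.deltaFun e, isEquivariant_deltaFun e, memℓp_gen <| by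
    refine summable_of_ne_finset_zero (s := {T.q e}) fun γ hγ => ?_
    rw [Finset.mem_singleton] at hγ
    rw [deltaFun_of_ne (by rw [T.q_lift]; exact fun h => hγ h.symm)]
    simp⟩

theorem delta_apply (e x : E) : T.delta e x = T.deltaFun e x := rfl

theorem delta_act_self (e : E) (z : Circle) : T.delta e (T.act z e) = z :=
  deltaFun_act_self e z

theorem delta_self (e : E) : T.delta e e = 1 := by
  have h := delta_act_self (T := T) e 1
  rwa [act_one, Circle.coe_one] at h

namespace L2

theorem equivariant (ξ : T.L2) : T.IsEquivariant ξ := ξ.2.1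

theorem hasSum_inner (ξ η : T.L2) :
    HasSum (fun γ => conj (ξ (T.lift γ)) * η (T.lift γ)) (inner ℂ ξ η) := by
  have h := lp.hasSum_inner (𝕜 := ℂ) (toLp T ξ) (toLp T η)
  simp only [RCLike.inner_apply', toLp_apply] at h
  exact h

end L2

/-- The phases cancel as `conj z * z = 1`. Inner products may therefore be computed with any
representatives of the fibres of `q`. -/
theorem conj_mul_eq {f g : E → ℂ} (hf : T.IsEquivariant f) (hg : T.IsEquivariant g) {x y : E}
    (h : T.q x = T.q y) : conj (f x) * g x = conj (f y) * g y := by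
  obtain ⟨z, rfl⟩ := exists_act h
  have hz : conj (z : ℂ) * z = 1 := by
    rw [← Circle.coe_inv_eq_conj, ← Circle.coe_mul, inv_mul_cancel, Circle.coe_one]
  rw [hf, hg, map_mul, mul_mul_mul_comm, hz, one_mul]

/-- Point masses reproduce values, so evaluation at a point of `E` is a bounded functional on `ℓ²(G;
E)`. -/
theorem inner_delta (e : E) (ξ : T.L2) : inner ℂ (T.delta e) ξ = ξ e := by
  rw [← (L2.hasSum_inner (T.delta e) ξ).tsum_eq, tsum_eq_single (T.q e)]
  · rw [conj_mul_eq (L2.equivariant _) (L2.equivariant _) (T.q_lift (T.q e)), delta_self,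
      map_one, one_mul]
  · intro γ hγ
    rw [delta_apply, deltaFun_of_ne (by rw [T.q_lift]; exact hγ.symm), map_zero, zero_mul]

theorem norm_delta (e : E) : ‖T.delta e‖ = 1 := by
  have h := inner_self_eq_norm_sq (𝕜 := ℂ) (T.delta e)
  rw [inner_delta, delta_self, RCLike.one_re] at h
  exact (pow_eq_one_iff_of_nonneg (norm_nonneg _) two_ne_zero).1 h.symm

theorem L2.norm_apply_le (ξ : T.L2) (e : E) : ‖ξ e‖ ≤ ‖ξ‖ := by
  have h := norm_inner_le_norm (𝕜 := ℂ) (T.delta e) ξ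
  rwa [inner_delta, norm_delta, one_mul] at h

theorem adjoint_delta_apply (a : T.L2 →L[ℂ] T.L2) (e x : E) :
    (star a) (T.delta e) x = conj (a (T.delta x) e) := by
  rw [← inner_delta x, ContinuousLinearMap.star_eq_adjoint,
    ContinuousLinearMap.adjoint_inner_right, ← inner_conj_symm, inner_delta]

/-- Operators on `ℓ²(G; E)` are determined by their matrix coefficients. -/
theorem ext_delta {a b : T.L2 →L[ℂ] T.L2}
    (h : ∀ e x, a (T.delta e) x = b (T.delta e) x) : a = b := by
  ext1 ξ
  apply Subtype.ext
  funext e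
  -- Passing to adjoints replaces a density argument for the span of point masses: `a ξ e = ⟪a* δ_e,
  -- ξ⟫` for every `ξ`, and `a* δ_e` is known from the coefficients.
  have h1 : star a (T.delta e) = star b (T.delta e) := by
    apply Subtype.ext
    funext x
    exact (adjoint_delta_apply a e x).trans
      ((congrArg conj (h x e)).trans (adjoint_delta_apply b e x).symm)
  change a ξ e = b ξ e
  rw [← inner_delta e (a ξ), ← inner_delta e (b ξ), ← ContinuousLinearMap.adjoint_inner_left,
    ← ContinuousLinearMap.adjoint_inner_left, ← ContinuousLinearMap.star_eq_adjoint,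
    ← ContinuousLinearMap.star_eq_adjoint, h1]

/-! Coefficient functions of operators -/

/-- The function on `E` whose value at `e` is the coefficient of `a δ_{s(e)}` at `e`. -/
noncomputable def coeff (a : T.L2 →L[ℂ] T.L2) (e : E) : ℂ := a (T.delta (s e)) e

theorem norm_coeff_le (a : T.L2 →L[ℂ] T.L2) (e : E) : ‖coeff a e‖ ≤ ‖a‖ := by
  have h := (L2.norm_apply_le _ e).trans (a.le_opNorm (T.delta (s e)))
  rwa [norm_delta, mul_one] at h

theorem coeff_sub (a b : T.L2 →L[ℂ] T.L2) (e : E) :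
    coeff (a - b) e = coeff a e - coeff b e := rfl

theorem isEquivariant_coeff (a : T.L2 →L[ℂ] T.L2) : T.IsEquivariant (coeff a) := by
  intro z e
  rw [coeff, s_act, L2.equivariant, coeff]

open Classical in
/-- Operators that commute with the right translations, expressed by matrix coefficients. -/
def IsRightInvariant (a : T.L2 →L[ℂ] T.L2) : Prop :=
  ∀ e₀ e, a (T.delta e₀) e = if s e = s e₀ then coeff a (e * e₀⁻¹) else 0

theorem continuous_delta_apply (e x : E) :
    Continuous fun a : T.L2 →L[ℂ] T.L2 => a (T.delta e) x := by
  simp_rw [← inner_delta x]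
  exact continuous_const.inner (continuous_id.clm_apply continuous_const)

/-- Each instance of the condition equates functions of `a` that are norm continuous, being matrix
coefficients or zero. This lets right invariance pass to the closure. -/
theorem isClosed_isRightInvariant :
    IsClosed {a : T.L2 →L[ℂ] T.L2 | IsRightInvariant a} := by
  simp only [IsRightInvariant, Set.ofPred_forall]
  refine isClosed_iInter fun e₀ => isClosed_iInter fun e => ?_
  refine isClosed_eq (continuous_delta_apply e₀ e) ?_
  split_ifs
  · exact continuous_delta_apply _ _
  · exact continuous_const

theorem IsRightInvariant.ext {a b : T.L2 →L[ℂ] T.L2} (ha : IsRightInvariant a)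
    (hb : IsRightInvariant b) (h : ∀ e, coeff a e = coeff b e) : a = b :=
  ext_delta fun e x => by rw [ha, hb]; split_ifs <;> simp only [h]

/-- The adjoint swaps the two points, giving the coefficient of `a δ_e` at `s e`; right invariance
turns it into the coefficient function at `s(e) e⁻¹ = e⁻¹`. -/
theorem IsRightInvariant.coeff_star {a : T.L2 →L[ℂ] T.L2} (ha : IsRightInvariant a) (e : E) :
    coeff (star a) e = conj (coeff a e⁻¹) := by
  rw [coeff, adjoint_delta_apply, ha, if_pos (s_s e), s_mul_inv]

/-- This is the inner product `⟪a* δ_{e'}, b δ_{s(e')}⟫` written as a sum over `G`. The substitution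
`η ↦ η⁻¹ q(e')` identifies `G^{r(e')}` with the arrows of source `s(q(e'))`, the only ones that
contribute. -/
theorem IsRightInvariant.hasSum_coeff_mul {a b : T.L2 →L[ℂ] T.L2} (ha : IsRightInvariant a)
    (hb : IsRightInvariant b) (e' : E) (e : {η : G // r η = r (T.q e')} → E)
    (he : ∀ η, T.q (e η) = η) :
    HasSum (fun η => coeff a (e η) * coeff b ((e η)⁻¹ * e')) (coeff (a * b) e') := by
  have hr : ∀ η, r (e η) = r e' := fun η => (r_eq_iff (T := T)).2 (by rw [he, η.2])
  have hc : ∀ η, s (e η)⁻¹ = r e' := fun η => (s_inv' _).trans (hr η)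
  set i : {η : G // r η = r (T.q e')} → G := fun η => η.1⁻¹ * T.q e' with hi
  have hqi : ∀ η, T.q ((e η)⁻¹ * e') = i η := fun η => by
    rw [T.q_mul _ _ (hc η), q_inv, he]
  have hinj : Function.Injective i := by
    intro η η' h
    have h1 : ∀ η : {η : G // r η = r (T.q e')}, i η * (T.q e')⁻¹ = η.1⁻¹ := fun η =>
      mul_inv_cancel_right' ((s_inv' _).trans η.2)
    have h2 : η.1⁻¹ = η'.1⁻¹ := by rw [← h1, ← h1, h]
    apply Subtype.ext
    rw [← ArrowGroupoid.inv_inv' η.1, h2, ArrowGroupoid.inv_inv']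
  have hsum := L2.hasSum_inner (star a (T.delta e')) (b (T.delta (s e')))
  have hval : inner ℂ (star a (T.delta e')) (b (T.delta (s e'))) = coeff (a * b) e' := by
    rw [ContinuousLinearMap.star_eq_adjoint, ContinuousLinearMap.adjoint_inner_left, inner_delta]
    rfl
  rw [hval, ← hinj.hasSum_iff] at hsum
  · convert hsum using 1
    funext η
    -- With `x = (e η)⁻¹ e'` as representative, the first factor is the coefficient of `a δ_x` at
    -- `e'`, that is, `coeff a` at `e' x⁻¹ = e η`; the second is `coeff b x`.
    have hs : s e' = s ((e η)⁻¹ * e') := (s_mul' _ _ (hc η)).symm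
    rw [Function.comp_apply, conj_mul_eq (L2.equivariant _) (L2.equivariant _)
      ((T.q_lift _).trans (hqi η).symm), adjoint_delta_apply, RingHomCompTriple.comp_apply,
      RingHom.id_apply, ha, if_pos hs, hb, if_pos (by rw [s_s, hs]), s_inv_s,
      mul_inv_rev' (hc η), ArrowGroupoid.inv_inv', hs, mul_s_self]
    congr 2
    rw [mul_inv_cancel_left' (hr η).symm]
  · intro γ hγ
    -- An arrow with source `s(q(e'))` would be the image of `q(e') γ⁻¹`; so off the range the
    -- sources differ and `b δ_{s(e')}` vanishes.
    have hne : s (T.lift γ) ≠ s (s e') := by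
      intro h
      rw [s_s, s_eq_iff (T := T), T.q_lift] at h
      refine hγ ⟨⟨T.q e' * γ⁻¹, r_mul' _ _ (h.symm.trans (r_inv' γ).symm)⟩, ?_⟩
      change (T.q e' * γ⁻¹)⁻¹ * T.q e' = γ
      rw [mul_inv_rev' (h.symm.trans (r_inv' γ).symm), ArrowGroupoid.inv_inv',
        inv_mul_cancel_right' h]
    rw [hb, if_neg hne, mul_zero]

/-! The regular representation is a `*`-representation -/

theorem continuous_rangeUnit_q [IsTopological G] : Continuous fun e => rangeUnit (T.q e) :=
  (continuous_r.comp T.continuous_q).subtype_mk _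

/-- The choice `lift` need not be continuous, but the product does not depend on it. It pulls back
to the continuous function `f x * g (x⁻¹ e)` of pairs `(x, e)` in `E` with equal ranges, and these
pairs map onto the domain by a quotient map. -/
theorem continuousOn_conv_term [IsTopological E] {f g : C(E, ℂ)} (hf : T.IsEquivariant f)
    (hg : T.IsEquivariant g) :
    ContinuousOn (fun p : G × E => f (T.lift p.1) * g ((T.lift p.1)⁻¹ * p.2))
      {p | r p.1 = r (T.q p.2)} := by
  let S := {p : E × E // s p.1⁻¹ = r p.2}
  have hcomp : ∀ p : S, r p.1.1 = r p.1.2 := fun p => (s_inv' _).symm.trans p.2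
  let Q : S → {p : G × E // r p.1 = r (T.q p.2)} :=
    fun p => ⟨(T.q p.1.1, p.1.2), (r_eq_iff (T := T)).1 (hcomp p)⟩
  have hlift : ∀ p : G × E, r p.1 = r (T.q p.2) → s (T.lift p.1)⁻¹ = r p.2 := fun p hp => by
    rw [s_inv', r_eq_iff (T := T), T.q_lift, hp]
  have hQs : Function.Surjective Q := by
    rintro ⟨p, hp⟩
    refine ⟨⟨(T.lift p.1, p.2), hlift p hp⟩, Subtype.ext (Prod.ext (T.q_lift _) rfl)⟩
  have hQc : Continuous Q :=
    ((T.continuous_q.comp (continuous_fst.comp continuous_subtype_val)).prodMk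
      (continuous_snd.comp continuous_subtype_val)).subtype_mk _
  -- `Q` is `q × id` restricted to the full preimage of its target, and such a restriction of an
  -- open map is open.
  have hQo : IsOpenMap Q := by
    intro U hU
    obtain ⟨V, hV, rfl⟩ := isOpen_induced_iff.1 hU
    refine isOpen_induced_iff.2 ⟨Prod.map T.q id '' V,
      (T.isOpenMap_q.prodMap IsOpenMap.id) V hV, ?_⟩
    ext ⟨p, hp⟩
    constructor
    · rintro ⟨⟨x, e⟩, hxe, rfl⟩
      refine ⟨⟨(x, e), ?_⟩, hxe, rfl⟩
      exact (s_inv' x).trans ((r_eq_iff (T := T)).2 hp)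
    · rintro ⟨p', hp', h⟩
      exact ⟨p'.1, hp', congrArg Subtype.val h⟩
  rw [continuousOn_iff_continuous_domRestrict, (hQo.isQuotientMap hQc hQs).continuous_iff]
  have heq : Set.domRestrict {p : G × E | r p.1 = r (T.q p.2)}
      (fun p : G × E => f (T.lift p.1) * g ((T.lift p.1)⁻¹ * p.2)) ∘ Q =
      fun p : S => f p.1.1 * g (p.1.1⁻¹ * p.1.2) := by
    funext p
    refine mul_inv_mul_eq hf hg (T.q_lift _) ?_
    exact (r_eq_iff (T := T)).2 (by rw [T.q_lift]; exact (r_eq_iff (T := T)).1 (hcomp p))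
  rw [heq]
  refine (f.continuous.comp (continuous_fst.comp continuous_subtype_val)).mul
    (g.continuous.comp ?_)
  exact (IsTopological.continuous_mul (G := E)).comp
    (f := fun p : S => (⟨(p.1.1⁻¹, p.1.2), p.2⟩ : {p : E × E // s p.1 = r p.2}))
    (((IsTopological.continuous_inv.comp (continuous_fst.comp continuous_subtype_val)).prodMk
      (continuous_snd.comp continuous_subtype_val)).subtype_mk _)

/-- The convolution product on `C_c(G; E)`. -/
noncomputable def convCc [IsEtale G] [T2Space G] [IsTopological E] (f g : T.Cc) : T.Cc :=
  ⟨⟨T.conv f.1 g.1, by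
    obtain ⟨K, hK, hfK⟩ := f.2.2
    exact continuous_tsum_fiber (ρ := fun e => rangeUnit (T.q e)) continuous_rangeUnit_q
      (F := fun η e => f.1 (T.lift η) * g.1 ((T.lift η)⁻¹ * e))
      (continuousOn_conv_term f.2.1 g.2.1) hK
      fun η hη e => by rw [hfK _ (by rwa [T.q_lift]), zero_mul]⟩,
    fun z e => conv_act g.2.1 z e, by
      obtain ⟨K, hK, hfK⟩ := f.2.2
      obtain ⟨L, hL, hgL⟩ := g.2.2
      obtain ⟨M, hM, hKL⟩ := exists_compact_mul hK hL
      -- A nonzero term requires `η ∈ K` and `η⁻¹ q(e) ∈ L`, which puts `q(e)` in the products of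
      -- `K` and `L`.
      refine ⟨M, hM, fun e he => ?_⟩
      change T.conv f.1 g.1 e = 0
      refine (tsum_congr fun η => ?_).trans tsum_zero
      by_cases hη : η.1 ∈ K
      · rw [hgL _ fun hc => he ?_, mul_zero]
        have h1 : s (T.lift η.1)⁻¹ = r e := (s_inv' _).trans (r_lift η)
        rw [T.q_mul _ _ h1, q_inv, T.q_lift] at hc
        have h2 := hKL _ hη _ hc (by rw [r_mul' _ _ ((s_inv' _).trans η.2), r_inv'])
        rwa [mul_inv_cancel_left' η.2] at h2
      · rw [hfK _ (by rwa [T.q_lift]), zero_mul]⟩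

/-- The involution on `C_c(G; E)`. -/
noncomputable def starCc [IsTopological G] [IsTopological E] (f : T.Cc) : T.Cc :=
  ⟨⟨fun e => conj (f.1 e⁻¹),
    Complex.continuous_conj.comp (f.1.continuous.comp IsTopological.continuous_inv)⟩,
    f.2.1.star_inv, by
      obtain ⟨K, hK, hfK⟩ := f.2.2
      refine ⟨_, hK.image IsTopological.continuous_inv, fun e he => ?_⟩
      change conj (f.1 e⁻¹) = 0
      rw [hfK, map_zero]
      intro hc
      refine he ⟨_, hc, ?_⟩
      change (T.q e⁻¹)⁻¹ = T.q e
      rw [q_inv, ArrowGroupoid.inv_inv']⟩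

/-! ### Matrix coefficients of the regular representation -/

section Regular

variable [IsEtale G]

open Classical in
-- The term at `η` survives only if `η⁻¹ q(e) = q(e₀)`. This forces equal sources and `η = q(e
-- e₀⁻¹)`, so the sum has at most one nonzero term.
theorem leftRegular_delta (f : T.Cc) (e₀ e : E) :
    T.leftRegular f (T.delta e₀) e = if s e = s e₀ then f.1 (e * e₀⁻¹) else 0 := by
  have hq : ∀ η : {η : G // r η = r (T.q e)}, T.q ((T.lift η)⁻¹ * e) = η.1⁻¹ * T.q e :=
    fun η => by rw [T.q_mul _ _ ((s_inv' _).trans (r_lift η)), q_inv, T.q_lift]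
  rw [leftRegular_apply, conv]
  split_ifs with h
  · have hc : s e = r e₀⁻¹ := h.trans (r_inv' _).symm
    have hr : r (e * e₀⁻¹) = r e := r_mul' _ _ hc
    rw [tsum_eq_single ⟨T.q (e * e₀⁻¹), (r_eq_iff (T := T)).1 hr⟩]
    · have hr' : r (T.lift (T.q (e * e₀⁻¹))) = r e := by
        rw [← hr, r_eq_iff (T := T), T.q_lift]
      have h1 : (e * e₀⁻¹)⁻¹ * e = e₀ := by
        rw [mul_inv_rev' hc, ArrowGroupoid.inv_inv', inv_mul_cancel_right' h.symm]
      rw [mul_inv_mul_eq f.2.1 (L2.equivariant (T.delta e₀)) (T.q_lift _) hr', h1, delta_self,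
        mul_one]
    · intro η hη
      rw [delta_apply, deltaFun_of_ne, mul_zero]
      rw [hq]
      intro h1
      refine hη (Subtype.ext ?_)
      change η.1 = T.q (e * e₀⁻¹)
      rw [T.q_mul _ _ hc, q_inv, h1, mul_inv_rev' ((s_inv' _).trans η.2),
        ArrowGroupoid.inv_inv', mul_inv_cancel_left']
      rw [η.2]
  · refine (tsum_congr fun η => ?_).trans tsum_zero
    rw [delta_apply, deltaFun_of_ne, mul_zero]
    intro h1
    refine h ?_
    rw [(s_eq_iff (T := T)).2 (congrArg s h1), s_mul' _ _ ((s_inv' _).trans (r_lift η))]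

theorem coeff_leftRegular (f : T.Cc) (e : E) : coeff (T.leftRegular f) e = f.1 e := by
  rw [coeff, leftRegular_delta, if_pos (s_s e).symm, s_inv_s, mul_s_self]

theorem isRightInvariant_leftRegular (f : T.Cc) : IsRightInvariant (T.leftRegular f) :=
  fun e₀ e => by rw [leftRegular_delta, coeff_leftRegular]

theorem leftRegular_add (f g : T.Cc) :
    T.leftRegular (f + g) = T.leftRegular f + T.leftRegular g :=
  ext_delta fun e x => by
    refine Eq.trans ?_ (congrArg₂ (· + ·) (leftRegular_delta f e x)
      (leftRegular_delta g e x)).symm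
    rw [leftRegular_delta]
    split_ifs
    · rfl
    · exact (add_zero _).symm

theorem leftRegular_smul (c : ℂ) (f : T.Cc) :
    T.leftRegular (c • f) = c • T.leftRegular f :=
  ext_delta fun e x => by
    refine Eq.trans ?_ (congrArg (c * ·) (leftRegular_delta f e x)).symm
    rw [leftRegular_delta]
    split_ifs
    · rfl
    · exact (mul_zero _).symm

variable [IsTopological E]

theorem star_leftRegular (f : T.Cc) : star (T.leftRegular f) = T.leftRegular (starCc f) :=
  ext_delta fun e x => by
    rw [adjoint_delta_apply, leftRegular_delta, leftRegular_delta]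
    by_cases h : s x = s e
    · rw [if_pos h, if_pos h.symm]
      change _ = conj (f.1 (x * e⁻¹)⁻¹)
      rw [mul_inv_rev' (h.trans (r_inv' e).symm), ArrowGroupoid.inv_inv']
    · rw [if_neg h, if_neg (Ne.symm h), map_zero]

theorem leftRegular_mul [T2Space G] (f g : T.Cc) :
    T.leftRegular f * T.leftRegular g = T.leftRegular (convCc f g) :=
  ext_delta fun e x => by
    rw [leftRegular_delta]
    change T.conv f.1 (T.leftRegular g (T.delta e)) x = _
    have hs : ∀ η : {η : G // r η = r (T.q x)}, s ((T.lift η)⁻¹ * x) = s x := fun η =>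
      s_mul' _ _ ((s_inv' _).trans (r_lift η))
    split_ifs with h
    · change _ = T.conv f.1 g.1 (x * e⁻¹)
      have hc : s x = r e⁻¹ := h.trans (r_inv' e).symm
      have hr : r (T.q (x * e⁻¹)) = r (T.q x) := (r_eq_iff (T := T)).1 (r_mul' _ _ hc)
      unfold conv
      rw [hr]
      refine tsum_congr fun η => ?_
      rw [leftRegular_delta, if_pos ((hs η).trans h),
        mul_assoc' _ _ _ ((s_inv' _).trans (r_lift η)) hc]
    · refine (tsum_congr fun η => ?_).trans tsum_zero
      rw [leftRegular_delta, if_neg (by rwa [hs]), mul_zero]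

/-- The image of `C_c(G; E)` is dense in the reduced `C*`-algebra. -/
theorem reducedCStar_subset_closure [T2Space G] :
    (T.reducedCStar : Set (T.L2 →L[ℂ] T.L2)) ⊆ closure (Set.range T.leftRegular) := by
  -- It suffices that the range is already closed under the `*`-algebra operations: the algebra
  -- generated by it is then no larger.
  refine closure_mono fun a ha => ?_
  induction ha using NonUnitalStarAlgebra.adjoin_induction with
  | mem x hx => exact hx
  | add x y _ _ hx hy =>
    obtain ⟨f, rfl⟩ := hx
    obtain ⟨g, rfl⟩ := hy
    exact ⟨f + g, leftRegular_add f g⟩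
  | zero =>
    refine ⟨0, ?_⟩
    have h := leftRegular_add (0 : T.Cc) 0
    rw [add_zero] at h
    exact left_eq_add.1 h
  | mul x y _ _ hx hy =>
    obtain ⟨f, rfl⟩ := hx
    obtain ⟨g, rfl⟩ := hy
    exact ⟨convCc f g, (leftRegular_mul f g).symm⟩
  | smul c x _ hx =>
    obtain ⟨f, rfl⟩ := hx
    exact ⟨c • f, leftRegular_smul c f⟩
  | star x _ hx =>
    obtain ⟨f, rfl⟩ := hx
    exact ⟨starCc f, (star_leftRegular f).symm⟩

/-! ### Passage from `C_c(G; E)` to its closure -/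

theorem isRightInvariant_of_mem [T2Space G] (a : T.reducedCStar) :
    IsRightInvariant (a : T.L2 →L[ℂ] T.L2) :=
  closure_minimal (Set.range_subset_iff.2 isRightInvariant_leftRegular)
    isClosed_isRightInvariant (reducedCStar_subset_closure a.2)

/-- Operator norm approximation becomes uniform approximation because coefficients are bounded by
the norm. Continuity and vanishing at infinity of `coeff a` both follow from this. -/
theorem exists_Cc_approx [T2Space G] (a : T.reducedCStar) {ε : ℝ} (hε : 0 < ε) :
    ∃ f : T.Cc, ∀ e, ‖coeff (a : T.L2 →L[ℂ] T.L2) e - f.1 e‖ < ε := by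
  obtain ⟨_, ⟨f, rfl⟩, hf⟩ :=
    Metric.mem_closure_iff.1 (reducedCStar_subset_closure a.2) ε hε
  rw [dist_eq_norm] at hf
  refine ⟨f, fun e => ?_⟩
  rw [← coeff_leftRegular f e, ← coeff_sub]
  exact (norm_coeff_le _ e).trans_lt hf

theorem continuous_coeff [T2Space G] (a : T.reducedCStar) :
    Continuous (coeff (a : T.L2 →L[ℂ] T.L2)) := by
  refine continuous_of_uniform_approx_of_continuous fun u hu => ?_
  obtain ⟨ε, hε, hεu⟩ := Metric.mem_uniformity_dist.1 hu
  obtain ⟨f, hf⟩ := exists_Cc_approx a hε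
  exact ⟨f.1, f.1.continuous, fun e => hεu (by rw [dist_eq_norm]; exact hf e)⟩

theorem tendsto_coeff [T2Space G] (a : T.reducedCStar) :
    Tendsto (coeff (a : T.L2 →L[ℂ] T.L2)) (comap T.q (cocompact G)) (𝓝 0) := by
  rw [Metric.tendsto_nhds]
  intro ε hε
  obtain ⟨f, hf⟩ := exists_Cc_approx a hε
  obtain ⟨K, hK, hfK⟩ := f.2.2
  filter_upwards [preimage_mem_comap hK.compl_mem_cocompact] with e he
  have h := hf e
  rwa [hfK e he, ← dist_eq_norm] at h

variable (T) in
/-- The canonical map from the reduced `C*`-algebra to `C₀(G; E)`. -/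
noncomputable def coeffMap [T2Space G] : T.reducedCStar →ₗ[ℂ] T.CZero where
  toFun a := ⟨BoundedContinuousFunction.ofNormedAddCommGroup (coeff a.1) (continuous_coeff a)
    ‖a.1‖ (norm_coeff_le a.1), isEquivariant_coeff a.1, tendsto_coeff a⟩
  map_add' _ _ := rfl
  map_smul' _ _ := rfl

theorem coeffMap_apply [T2Space G] (a : T.reducedCStar) (e : E) :
    (T.coeffMap a).1 e = coeff a.1 e := rfl

end Regular

end GroupoidTwist

theorem mainTheorem2 {G E : Type*}
    [TopologicalSpace G] [ArrowGroupoid G] [IsEtale G]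
    [SecondCountableTopology G] [LocallyCompactSpace G] [T2Space G]
    [TopologicalSpace E] [ArrowGroupoid E] [IsTopological E]
    (T : GroupoidTwist G E) :
    ∃ j : T.reducedCStar →ₗ[ℂ] T.CZero,
      Function.Injective j ∧
      (∀ a, ‖j a‖ ≤ ‖a‖) ∧
      (∀ (f : T.Cc) (e : E), (j (T.toReduced f)).1 e = f.1 e) ∧
      (∀ (a : T.reducedCStar) (e : E), (j (star a)).1 e = conj ((j a).1 e⁻¹)) ∧
      (∀ (a b : T.reducedCStar) (e' : E)
        -- one point `e` in the fibre over each `η ∈ G^{r(e')}`, chosen arbitrarily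
        (e : {η : G // r η = r (T.q e')} → E), (∀ η, T.q (e η) = η) →
          Summable (fun η => ‖(j a).1 (e η) * (j b).1 ((e η)⁻¹ * e')‖) ∧
          HasSum (fun η => (j a).1 (e η) * (j b).1 ((e η)⁻¹ * e')) ((j (a * b)).1 e')) := by
  refine ⟨T.coeffMap, fun a b h => ?_, fun a => ?_, fun f e => GroupoidTwist.coeff_leftRegular f e,
    fun a e => (GroupoidTwist.isRightInvariant_of_mem a).coeff_star e, fun a b e' e he => ?_⟩
  · refine Subtype.ext ((GroupoidTwist.isRightInvariant_of_mem a).ext (GroupoidTwist.isRightInvariant_of_mem b) fun e => ?_)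
    rw [← GroupoidTwist.coeffMap_apply, h, GroupoidTwist.coeffMap_apply]
  · exact BoundedContinuousFunction.norm_ofNormedAddCommGroup_le _ (norm_nonneg a.1)
      (GroupoidTwist.norm_coeff_le a.1)
  · have h := (GroupoidTwist.isRightInvariant_of_mem a).hasSum_coeff_mul (GroupoidTwist.isRightInvariant_of_mem b) e' e he
    -- Unconditional summability of complex numbers is absolute summability.
    exact ⟨h.summable.norm, h⟩
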